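/- Let $d,m,r\ge 0$ be integers and let $G=\mathbb F_d * \mathbb Z/2\mathbb Z*\cdots*\mathbb Z/2\mathbb Z$ ($m$ factors $\mathbb Z/2\mathbb Z$), with identity $e$ and generating set $S=\{a_1^{\pm1},\dots,a_d^{\pm1},b_1,\dots,b_m\}$, where the $a_i$ are the free generators and $b_j$ is the nontrivial element of the $j$-th factor $\mathbb Z/2\mathbb Z$. Let $(p_g)_{g\in G}$ be nonnegative real $r\times r$ matrices with $p_g=0$ for $g\notin S$ such that $\sum_g p_g$ is stochastic, and let $(X_n)_{n\ge0}$ be the corresponding nearest-neighbor colored random walk, that is, the Markov chain on $G\times[r]$ that moves from $(g,u)$ to $(h,v)$ with probability $p_{g^{-1}h}(u,v)$. Write $\mathbb P_u$ for its law when $X_0=(e,u)$. Assume that the walk is transient: for every $u\in[r]$, $\mathbb P_u$-almost surely each state of $G\times[r]$ is visited only finitely often. Then for every $u$, $\mathbb P_u$-almost surely the $G$-component of $X_n$ converges to a unique infinite reduced word $X_\infty=\xi_1\xi_2\cdots$ (with $\xi_i\in S$ and $\xi_{i+1}\neq\xi_i^{-1}$), in the sense that for each $k$ the reduced word of the $G$-component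 of $X_n$ begins with $\xi_1\cdots\xi_k$ for all large $n$. For $g\in S$ let $\tau_g$ and $\tau_{(g,v)}$ be the first times at which $X_n$ has $G$-component $g$, respectively is equal to $(g,v)$, and define $r\times r$ matrices by $$q_g(u,v)=\mathbb P_u[\tau_g<\infty,\ \tau_g=\tau_{(g,v)}],\qquad \mu_g(u,v)=\mathbb P_u[\xi_1=g,\ X_{\tau_g}=(g,v)],$$ and let $d_g$ be the diagonal matrix with entries $d_g(u,u)=\sum_{w}q_g(u,w)$. Then for every $g\in S$ the matrix $I-q_{g^{-1}}q_g$ is invertible, and for all $u,v\in[r]$ $$\mu_g(u,v)=q_g(u,v)\sum_{w\in[r]}\bigl((I-q_{g^{-1}}q_g)^{-1}(I-d_{g^{-1}})\bigr)(v,w).$$ -/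

import Mathlib

open MeasureTheory Filter

/-- The free product `F_d * Z/2 * ... * Z/2` of the free group on `d` generators with `m` copies of
the group of order two. -/
abbrev FreeGp (d m : ℕ) : Type :=
  Monoid.Coprod (FreeGroup (Fin d)) (Monoid.CoprodI (fun _ : Fin m => Multiplicative (ZMod 2)))

namespace FreeGp

variable {d m : ℕ}

/-- The free generator `a_i`. -/
def a (i : Fin d) : FreeGp d m := Monoid.Coprod.inl (FreeGroup.of i)

/-- The nontrivial element `b_j` of the `j`-th factor `Z/2`. -/
def b (j : Fin m) : FreeGp d m :=
  Monoid.Coprod.inr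
    (Monoid.CoprodI.of (M := fun _ : Fin m => Multiplicative (ZMod 2)) (i := j)
      (Multiplicative.ofAdd 1))

/-- The symmetric generating set `S`: all `a_i`, all `a_i⁻¹` and all `b_j`. -/
def S (d m : ℕ) : Set (FreeGp d m) :=
  {g | (∃ i, g = a i) ∨ (∃ i, g = (a i)⁻¹) ∨ ∃ j, g = b j}

/-- The letters that may follow `g` in a reduced word. For `g = b_j` this removes `b_j` itself. -/
def Next (g : FreeGp d m) : Set (FreeGp d m) := S d m \ {g⁻¹}

/-- Finite reduced words. -/
def IsReducedWord (w : List (FreeGp d m)) : Prop :=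
  (∀ g ∈ w, g ∈ S d m) ∧ w.IsChain (fun g h => h ∈ Next g)

/-- Infinite reduced words: the points of the boundary of the group. -/
def IsBoundaryPoint (ξ : ℕ → FreeGp d m) : Prop :=
  (∀ i, ξ i ∈ S d m) ∧ ∀ i, ξ (i + 1) ∈ Next (ξ i)

/-- The sequence `x` of group elements converges to the infinite word `ξ`: for every `k`, the first
`k` letters of the reduced word of `x n` are those of `ξ`, for all large `n`. -/
def ConvergesTo (x : ℕ → FreeGp d m) (ξ : ℕ → FreeGp d m) : Prop :=
  ∀ k : ℕ, ∀ᶠ n in atTop,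
    ∃ w : List (FreeGp d m), IsReducedWord w ∧ w.prod = x n ∧ (List.range k).map ξ <+: w

end FreeGp

/-- A family `(p_g)` of nonnegative matrices whose sum over `g` is a stochastic matrix. -/
structure IsColoredKernel {G : Type*} {r : ℕ} (p : G → Matrix (Fin r) (Fin r) ℝ) : Prop where
  nonneg : ∀ g u v, 0 ≤ p g u v
  stochastic : ∀ u, HasSum (fun x : G × Fin r => p x.1 u x.2) 1

/-- Under `ℙ`, the process `X` is the Markov chain on `G × [r]` started at `(e, u)` which moves from
`(g, v)` to `(h, w)` with probability `p_{g⁻¹h}(v, w)`. -/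
structure IsColoredWalk {G : Type*} [Group G] {r : ℕ} {Ω : Type*} [MeasurableSpace Ω]
    (p : G → Matrix (Fin r) (Fin r) ℝ) (u : Fin r) (ℙ : Measure Ω)
    (X : ℕ → Ω → G × Fin r) : Prop where
  isProbabilityMeasure : IsProbabilityMeasure ℙ
  measurable : ∀ n x, MeasurableSet {ω | X n ω = x}
  start : ∀ᵐ ω ∂ℙ, X 0 ω = (1, u)
  markov : ∀ (n : ℕ) (x : ℕ → G × Fin r),
    ℙ.real {ω | ∀ k ≤ n + 1, X k ω = x k} =
      ℙ.real {ω | ∀ k ≤ n, X k ω = x k} * p ((x n).1⁻¹ * (x (n + 1)).1) (x n).2 (x (n + 1)).2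

namespace ColoredWalk

variable {G : Type*} {r : ℕ} {Ω : Type*}

/-- Transience: from each starting color, almost surely every state is visited only finitely often.
(The walk started at `(g, u)` is the translate by `g` of the walk started at `(e, u)`.) -/
def IsTransient [MeasurableSpace Ω] (ℙ : Fin r → Measure Ω) (X : ℕ → Ω → G × Fin r) : Prop :=
  ∀ (u : Fin r) (x : G × Fin r), ∀ᵐ ω ∂ℙ u, ∀ᶠ n in atTop, X n ω ≠ x

/-- The hitting time of a set of states, `⊤` if it is never visited. -/
noncomputable def hitTime (X : ℕ → Ω → G × Fin r) (A : Set (G × Fin r)) (ω : Ω) : ℕ∞ :=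
  sInf ((fun n : ℕ => (n : ℕ∞)) '' {n | X n ω ∈ A})

/-- `τ_g`, the hitting time of `g` with any color. -/
noncomputable def tau (X : ℕ → Ω → G × Fin r) (g : G) (ω : Ω) : ℕ∞ :=
  hitTime X {x | x.1 = g} ω

/-- `q_g(u, v)`: the probability, starting from `(e, u)`, that `g` is visited and that the first
visit happens with color `v`. -/
noncomputable def q [MeasurableSpace Ω] (ℙ : Fin r → Measure Ω) (X : ℕ → Ω → G × Fin r) (g : G) :
    Matrix (Fin r) (Fin r) ℝ :=
  Matrix.of fun u v => (ℙ u).real {ω | tau X g ω < ⊤ ∧ tau X g ω = hitTime X {(g, v)} ω}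

/-- The diagonal matrix `d_g` of the probabilities of ever visiting `g`. -/
noncomputable def dmat [MeasurableSpace Ω] (ℙ : Fin r → Measure Ω) (X : ℕ → Ω → G × Fin r)
    (g : G) : Matrix (Fin r) (Fin r) ℝ :=
  Matrix.diagonal fun u => ∑ w, q ℙ X g u w

/-- `ξ` is the limit `X_∞(ω)` of the trajectory in the boundary of the group. -/
def IsLimit {d m : ℕ} (X : ℕ → Ω → FreeGp d m × Fin r) (ω : Ω) (ξ : ℕ → FreeGp d m) : Prop :=
  FreeGp.IsBoundaryPoint ξ ∧ FreeGp.ConvergesTo (fun n => (X n ω).1) ξ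

/-- `μ_g(u, v)`: the probability, starting from `(e, u)`, that the first letter of `X_∞` is `g` and
that `X` is in the state `(g, v)` at time `τ_g`. -/
noncomputable def mu [MeasurableSpace Ω] {d m : ℕ} (ℙ : Fin r → Measure Ω)
    (X : ℕ → Ω → FreeGp d m × Fin r) (g : FreeGp d m) : Matrix (Fin r) (Fin r) ℝ :=
  Matrix.of fun u v => (ℙ u).real
    {ω | (∃ ξ, IsLimit X ω ξ ∧ ξ 0 = g) ∧ ∃ n : ℕ, tau X g ω = n ∧ X n ω = (g, v)}

end ColoredWalk

/-!
A step of the walk appends or deletes one letter of the reduced word of its position. To change a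
prefix `w` of that word, the walk must return to the element `w`, which by transience it
eventually stops doing; hence the words stabilise letter by letter, and the limit can begin with
`g` only if `g` is visited. Seen from the first visit to `g`, the limit begins with `g` unless the
walk restarted there has a limit beginning with `g⁻¹`. Writing `F_g(u)` for the probability that
the limit begins with `g`, the strong Markov property at that visit gives
`μ_g(u, v) = q_g(u, v) (1 - F_{g⁻¹}(v))`, and summing over `v` gives `F_g = q_g (1 - F_{g⁻¹})`.
Together with the same equation for `g⁻¹` this is the linear system
`(1 - q_{g⁻¹} q_g) (1 - F_{g⁻¹}) = 1 - q_{g⁻¹} 1`. Its matrix is invertible because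
`(q_{g⁻¹} q_g)^k 1` is at most the probability of visiting `e` at some time `≥ 2 k`, which tends
to `0` by transience.
-/

/-! ### Reduced words -/

section Words

variable {G : Type*} [Group G] {S : Set G} {s g : G} {w : List G}

/-- Reduced words in the alphabet `S`: words with letters in `S` in which no letter is followed by
its inverse. -/
def IsReducedIn (S : Set G) (w : List G) : Prop :=
  (∀ g ∈ w, g ∈ S) ∧ w.IsChain (fun g h => h ∈ S \ {g⁻¹})

theorem isReducedIn_nil : IsReducedIn S [] := ⟨by simp, .nil⟩

theorem isReducedIn_cons :
    IsReducedIn S (s :: w) ↔ s ∈ S ∧ w.head? ≠ some s⁻¹ ∧ IsReducedIn S w := by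
  simp only [IsReducedIn, List.forall_mem_cons, List.isChain_cons, Set.mem_sdiff,
    Set.mem_singleton_iff]
  constructor
  · rintro ⟨⟨hs, hw⟩, hhead, hchain⟩
    exact ⟨hs, fun h => (hhead _ h).2 rfl, hw, hchain⟩
  · rintro ⟨hs, hhead, hw, hchain⟩
    exact ⟨⟨hs, hw⟩, fun t ht => ⟨hw t (List.mem_of_mem_head? ht), fun h => hhead (h ▸ ht)⟩, hchain⟩

theorem isReducedIn_concat :
    IsReducedIn S (w ++ [s]) ↔ IsReducedIn S w ∧ s ∈ S ∧ w.getLast? ≠ some s⁻¹ := by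
  simp only [IsReducedIn, List.forall_mem_append, List.forall_mem_singleton, List.isChain_append,
    List.isChain_singleton, List.head?_cons, Option.mem_def, Option.some.injEq, forall_eq',
    Set.mem_sdiff, Set.mem_singleton_iff, true_and]
  constructor
  · rintro ⟨⟨hw, hs⟩, hchain, hlast⟩
    exact ⟨⟨hw, hchain⟩, hs, fun h => (hlast _ h).2 (inv_inv s).symm⟩
  · rintro ⟨⟨hw, hchain⟩, hs, hlast⟩
    exact ⟨⟨hw, hs⟩, hchain, fun t ht => ⟨hs, fun h => hlast (by rw [ht, h, inv_inv])⟩⟩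

open scoped Classical in
/-- The reduction of the word `s :: w`, for a reduced word `w`. -/
noncomputable def reducedCons (s : G) (w : List G) : List G :=
  if w.head? = some s⁻¹ then w.tail else s :: w

theorem reducedCons_of_head?_eq (h : w.head? = some s⁻¹) : reducedCons s w = w.tail := if_pos h

theorem reducedCons_of_head?_ne (h : w.head? ≠ some s⁻¹) : reducedCons s w = s :: w := if_neg h

theorem prod_reducedCons (s : G) (w : List G) : (reducedCons s w).prod = s * w.prod := by
  by_cases h : w.head? = some s⁻¹
  · rw [reducedCons_of_head?_eq h, ← List.cons_head?_tail h, List.prod_cons, mul_inv_cancel_left,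
      List.tail_cons]
  · rw [reducedCons_of_head?_ne h, List.prod_cons]

namespace IsReducedIn

theorem reducedCons (hw : IsReducedIn S w) (hs : s ∈ S) : IsReducedIn S (reducedCons s w) := by
  by_cases h : w.head? = some s⁻¹
  · rw [reducedCons_of_head?_eq h]
    rw [← List.cons_head?_tail h] at hw
    exact (isReducedIn_cons.1 hw).2.2
  · rw [reducedCons_of_head?_ne h]
    exact isReducedIn_cons.2 ⟨hs, h, hw⟩

theorem reducedCons_inv_reducedCons (hw : IsReducedIn S w) (s : G) :
    _root_.reducedCons s⁻¹ (_root_.reducedCons s w) = w := by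
  by_cases h : w.head? = some s⁻¹
  · rw [reducedCons_of_head?_eq h]
    rw [← List.cons_head?_tail h] at hw
    rw [reducedCons_of_head?_ne (isReducedIn_cons.1 hw).2.1, List.cons_head?_tail h]
  · rw [reducedCons_of_head?_ne h, reducedCons_of_head?_eq (by simp), List.tail_cons]

theorem head?_reducedCons_eq_iff (hw : IsReducedIn S w) (s : G) :
    (_root_.reducedCons s w).head? = some s ↔ w.head? ≠ some s⁻¹ := by
  by_cases h : w.head? = some s⁻¹
  · rw [reducedCons_of_head?_eq h]
    rw [← List.cons_head?_tail h] at hw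
    simpa [h] using (isReducedIn_cons.1 hw).2.1
  · simp [reducedCons_of_head?_ne h, h]

end IsReducedIn

/-- Left multiplication by a letter as a permutation of the reduced words. -/
noncomputable def reducedConsPerm (hS : ∀ s ∈ S, s⁻¹ ∈ S) (s : G) (hs : s ∈ S) :
    Equiv.Perm {w // IsReducedIn S w} where
  toFun w := ⟨reducedCons s w, w.2.reducedCons hs⟩
  invFun w := ⟨reducedCons s⁻¹ w, w.2.reducedCons (hS s hs)⟩
  left_inv w := Subtype.ext (w.2.reducedCons_inv_reducedCons s)
  right_inv w := Subtype.ext (by simpa using w.2.reducedCons_inv_reducedCons s⁻¹)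

/-- Every group element is the product of a unique reduced word in `S`; equivalently, the Cayley
graph of `S` is a tree. -/
def HasUniqueReducedWords (S : Set G) : Prop :=
  ∀ g : G, ∃! w : List G, IsReducedIn S w ∧ w.prod = g

section Action

variable (hinv : ∀ s ∈ S, s⁻¹ ∈ S) {φ : G →* Equiv.Perm {w // IsReducedIn S w}}
  (hφ : ∀ s hs, φ s = reducedConsPerm hinv s hs)
include hφ

theorem prod_reducedConsPerm_action (hgen : Subgroup.closure S = ⊤) (g : G)
    (w : {w // IsReducedIn S w}) : (φ g w).1.prod = g * w.1.prod := by
  have hg : g ∈ Subgroup.closure S := hgen ▸ Subgroup.mem_top g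
  induction hg using Subgroup.closure_induction generalizing w with
  | mem s hs => rw [hφ s hs]; exact prod_reducedCons s w
  | one => simp
  | mul g h _ _ ihg ihh => rw [map_mul, Equiv.Perm.mul_apply, ihg, ihh, mul_assoc]
  | inv g _ ih =>
    rw [eq_inv_mul_iff_mul_eq, ← ih, ← Equiv.Perm.mul_apply, ← map_mul, mul_inv_cancel, map_one,
      Equiv.Perm.one_apply]

theorem reducedConsPerm_action_prod_nil (hw : IsReducedIn S w) :
    (φ w.prod ⟨[], isReducedIn_nil⟩).1 = w := by
  induction w with
  | nil => simp
  | cons s w ih =>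
    obtain ⟨hs, hhead, hw⟩ := isReducedIn_cons.1 hw
    rw [List.prod_cons, map_mul, Equiv.Perm.mul_apply, hφ s hs]
    exact (congrArg (reducedCons s) (ih hw)).trans (reducedCons_of_head?_ne hhead)

/-- Van der Waerden's trick: the group acts on the reduced words, and the orbit map of the empty
word inverts the product map. -/
theorem hasUniqueReducedWords_of_action (hgen : Subgroup.closure S = ⊤) :
    HasUniqueReducedWords S := fun g => by
  refine ⟨(φ g ⟨[], isReducedIn_nil⟩).1, ⟨(φ g _).2, ?_⟩, ?_⟩
  · simpa using prod_reducedConsPerm_action hinv hφ hgen g ⟨[], isReducedIn_nil⟩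
  · rintro w ⟨hw, rfl⟩
    exact (reducedConsPerm_action_prod_nil hinv hφ hw).symm

end Action

end Words

/-- Convergence of the sequence `x` to the infinite reduced word `ξ` in the alphabet `S`: for every
`k`, the reduced word of `x n` begins with the first `k` letters of `ξ` for all large `n`. -/
def IsBoundaryLimit {G : Type*} [Group G] (S : Set G) (x ξ : ℕ → G) : Prop :=
  ((∀ i, ξ i ∈ S) ∧ ∀ i, ξ (i + 1) ∈ S \ {(ξ i)⁻¹}) ∧
    ∀ k : ℕ, ∀ᶠ n in atTop,
      ∃ w : List G, IsReducedIn S w ∧ w.prod = x n ∧ (List.range k).map ξ <+: w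

namespace HasUniqueReducedWords

variable {G : Type*} [Group G] {S : Set G} (hS : HasUniqueReducedWords S) {s g : G}

/-- The reduced word of a group element. -/
noncomputable def word (g : G) : List G := (hS g).choose

theorem isReducedIn_word (g : G) : IsReducedIn S (hS.word g) := (hS g).choose_spec.1.1

theorem prod_word (g : G) : (hS.word g).prod = g := (hS g).choose_spec.1.2

theorem word_eq {w : List G} (hw : IsReducedIn S w) (h : w.prod = g) : hS.word g = w :=
  (hS g).unique ⟨hS.isReducedIn_word g, hS.prod_word g⟩ ⟨hw, h⟩

theorem word_one : hS.word 1 = [] := hS.word_eq isReducedIn_nil rfl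

include hS in
theorem ne_one_of_mem (hs : s ∈ S) : s ≠ 1 := by
  rintro rfl
  have hw : hS.word 1 = [1] :=
    hS.word_eq (isReducedIn_cons.2 ⟨hs, by simp, isReducedIn_nil⟩) (by simp)
  simp [hS.word_one] at hw

include hS in
theorem inv_mem (hs : s ∈ S) : s⁻¹ ∈ S := by
  by_contra hinv
  have hhead : (hS.word s⁻¹).head? ≠ some s⁻¹ := fun h =>
    hinv ((hS.isReducedIn_word s⁻¹).1 _ (List.mem_of_mem_head? h))
  have hword : hS.word 1 = s :: hS.word s⁻¹ :=
    hS.word_eq (isReducedIn_cons.2 ⟨hs, hhead, hS.isReducedIn_word s⁻¹⟩) (by simp [hS.prod_word])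
  simp [hS.word_one] at hword

include hS in
theorem countable (hcount : S.Countable) : Countable G := by
  have : Countable S := hcount
  refine Function.Surjective.countable (f := fun w : List S => (w.map Subtype.val).prod) fun g => ?_
  exact ⟨(hS.word g).attachWith _ (hS.isReducedIn_word g).1, by simp [hS.prod_word]⟩

theorem word_mul_left (hs : s ∈ S) (g : G) : hS.word (s * g) = reducedCons s (hS.word g) :=
  hS.word_eq ((hS.isReducedIn_word g).reducedCons hs) (by rw [prod_reducedCons, hS.prod_word])

theorem head?_word_mul_left (hs : s ∈ S) (g : G) :
    (hS.word (s * g)).head? = some s ↔ (hS.word g).head? ≠ some s⁻¹ := by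
  rw [hS.word_mul_left hs, (hS.isReducedIn_word g).head?_reducedCons_eq_iff]

theorem word_mul_right (g : G) (hs : s ∈ S) :
    hS.word (g * s) = hS.word g ++ [s] ∨ hS.word g = hS.word (g * s) ++ [s⁻¹] := by
  have hword := hS.isReducedIn_word g
  by_cases h : (hS.word g).getLast? = some s⁻¹
  · right
    obtain ⟨w, hw⟩ := List.getLast?_eq_some_iff.1 h
    rw [hw] at hword
    have hprod : w.prod = g * s := by rw [← hS.prod_word g, hw]; simp
    rw [hw, hS.word_eq (isReducedIn_concat.1 hword).1 hprod]
  · left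
    exact hS.word_eq (isReducedIn_concat.2 ⟨hword, hs, h⟩) (by simp [hS.prod_word])

/-- The sequences whose reduced words eventually begin with the letter `g`. -/
def cone (g : G) : Set (ℕ → G) := {x | ∀ᶠ n in atTop, (hS.word (x n)).head? = some g}

theorem shift_mem_cone_iff (x : ℕ → G) (n : ℕ) :
    (fun k => x (n + k)) ∈ hS.cone g ↔ x ∈ hS.cone g := by
  simp only [cone, Set.mem_ofPred_eq, add_comm n]
  rw [← eventually_map (m := fun k => k + n) (P := fun k => (hS.word (x k)).head? = some g),
    map_add_atTop_eq_nat]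

theorem measurableSet_cone [MeasurableSpace G] [DiscreteMeasurableSpace G] (g : G) :
    MeasurableSet (hS.cone g) := by
  have hcone : hS.cone g =
      ⋃ N, ⋂ n, ⋂ (_ : n ≥ N), (fun x : ℕ → G => x n) ⁻¹' {h | (hS.word h).head? = some g} := by
    ext
    simp [cone, eventually_atTop]
  rw [hcone]
  exact .iUnion fun _ => .iInter fun n => .iInter fun _ => measurable_pi_apply n .of_discrete

theorem eventually_getElem?_word {x ξ : ℕ → G} (h : IsBoundaryLimit S x ξ) (k : ℕ) :
    ∀ᶠ n in atTop, (hS.word (x n))[k]? = some (ξ k) := by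
  filter_upwards [h.2 (k + 1)] with n hn
  obtain ⟨_, hw, hwx, v, rfl⟩ := hn
  rw [hS.word_eq hw hwx, List.getElem?_append_left (by simp)]
  simp

theorem isBoundaryLimit_of_eventually_getElem? {x ξ : ℕ → G}
    (h : ∀ k, ∀ᶠ n in atTop, (hS.word (x n))[k]? = some (ξ k)) : IsBoundaryLimit S x ξ := by
  refine ⟨⟨fun i => ?_, fun i => ?_⟩, fun k => ?_⟩
  · obtain ⟨n, hn⟩ := (h i).exists
    exact (hS.isReducedIn_word (x n)).1 _ (List.mem_of_getElem? hn)
  · obtain ⟨n, hn, hn'⟩ := ((h i).and (h (i + 1))).exists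
    obtain ⟨_, hi⟩ := List.getElem?_eq_some_iff.1 hn
    obtain ⟨hlt, hi'⟩ := List.getElem?_eq_some_iff.1 hn'
    simpa only [hi, hi'] using List.isChain_iff_getElem.1 (hS.isReducedIn_word (x n)).2 i hlt
  · filter_upwards [(eventually_all_finset (Finset.range k)).2 fun i _ => h i] with n hn
    refine ⟨hS.word (x n), hS.isReducedIn_word _, hS.prod_word _, ?_⟩
    rw [List.prefix_iff_getElem?]
    intro i hi
    rw [List.length_map, List.length_range] at hi
    simpa using hn i (by simpa using hi)

section NearestNeighborPath

variable {x : ℕ → G} (hx : ∀ n, (x n)⁻¹ * x (n + 1) ∈ S)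
include hx

theorem word_succ_eq_or (n : ℕ) :
    (∃ s, hS.word (x (n + 1)) = hS.word (x n) ++ [s]) ∨
      ∃ s, hS.word (x n) = hS.word (x (n + 1)) ++ [s] := by
  have hstep := hS.word_mul_right (x n) (hx n)
  rw [mul_inv_cancel_left] at hstep
  exact hstep.imp (fun h => ⟨_, h⟩) fun h => ⟨_, h⟩

/-- The first time the word begins with `g`, it equals `[g]`, because words grow one letter at a
time. -/
theorem exists_eq_of_head?_word (h0 : x 0 = 1) {n : ℕ} (hn : (hS.word (x n)).head? = some g) :
    ∃ k, x k = g := by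
  induction n with
  | zero => simp [h0, hS.word_one] at hn
  | succ n ih =>
    rcases hS.word_succ_eq_or hx n with ⟨s, hs⟩ | ⟨s, hs⟩
    · rcases hword : hS.word (x n) with _ | ⟨t, w⟩
      · rw [hs, hword] at hn
        refine ⟨n + 1, ?_⟩
        rw [← hS.prod_word (x (n + 1)), hs, hword]
        simpa using hn
      · refine ih ?_
        rw [hs, hword] at hn
        simpa [hword] using hn
    · exact ih (by rw [hs, List.head?_append, hn, Option.some_or])

theorem prefix_word_of_length_le {w : List G} {N : ℕ} (hw : w <+: hS.word (x N))
    (hlen : ∀ n ≥ N, w.length ≤ (hS.word (x n)).length) : ∀ n ≥ N, w <+: hS.word (x n) := by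
  intro n hn
  induction n, hn using Nat.le_induction with
  | base => exact hw
  | succ n hn ih =>
    rcases hS.word_succ_eq_or hx n with ⟨s, hs⟩ | ⟨s, hs⟩
    · exact hs ▸ ih.trans (List.prefix_append _ _)
    · exact List.prefix_of_prefix_length_le ih (hs ▸ List.prefix_append _ _) (hlen _ (by omega))

variable (ht : ∀ g, ∀ᶠ n in atTop, x n ≠ g)
include ht

/-- Once the path has left the element with word `w` for the last time while staying below it, the
next letter can no longer change. -/
theorem exists_eventually_prefix_word (k : ℕ) :
    ∃ w : List G, w.length = k ∧ ∀ᶠ n in atTop, w <+: hS.word (x n) := by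
  induction k with
  | zero => exact ⟨[], rfl, .of_forall fun n => List.nil_prefix⟩
  | succ k ih =>
    obtain ⟨w, rfl, hw⟩ := ih
    have hlen : ∀ᶠ n in atTop, w.length + 1 ≤ (hS.word (x n)).length := by
      filter_upwards [hw, ht w.prod] with n hpre hne
      refine Nat.succ_le_of_lt (hpre.length_le.lt_of_ne fun hlen => hne ?_)
      rw [hpre.eq_of_length hlen, hS.prod_word]
    obtain ⟨N, hN⟩ := eventually_atTop.1 hlen
    have htake : ((hS.word (x N)).take (w.length + 1)).length = w.length + 1 :=
      List.length_take_of_le (hN N le_rfl)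
    exact ⟨_, htake, eventually_atTop.2 ⟨N, hS.prefix_word_of_length_le hx (List.take_prefix _ _)
      (by simpa only [htake] using hN)⟩⟩

theorem exists_eventually_getElem?_word (k : ℕ) :
    ∃ s, ∀ᶠ n in atTop, (hS.word (x n))[k]? = some s := by
  obtain ⟨w, hlen, hw⟩ := hS.exists_eventually_prefix_word hx ht (k + 1)
  refine ⟨w[k], hw.mono fun n hn => ?_⟩
  exact List.prefix_iff_getElem?.1 hn k (by omega)

include hS in
theorem existsUnique_isBoundaryLimit : ∃! ξ, IsBoundaryLimit S x ξ := by
  choose ξ hξ using hS.exists_eventually_getElem?_word hx ht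
  refine ⟨ξ, hS.isBoundaryLimit_of_eventually_getElem? hξ, fun ζ hζ => funext fun k => ?_⟩
  obtain ⟨n, hn, hn'⟩ := ((hξ k).and (hS.eventually_getElem?_word hζ k)).exists
  exact Option.some_injective _ (hn'.symm.trans hn)

theorem exists_isBoundaryLimit_zero_eq_iff :
    (∃ ξ, IsBoundaryLimit S x ξ ∧ ξ 0 = g) ↔ x ∈ hS.cone g := by
  obtain ⟨ξ, hξ, huniq⟩ := hS.existsUnique_isBoundaryLimit hx ht
  have hhead : ∀ᶠ n in atTop, (hS.word (x n)).head? = some (ξ 0) := by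
    simpa only [List.head?_eq_getElem?] using hS.eventually_getElem?_word hξ 0
  constructor
  · rintro ⟨ζ, hζ, rfl⟩
    rwa [huniq ζ hζ]
  · intro hg
    obtain ⟨n, hn, hn'⟩ := (hhead.and hg).exists
    exact ⟨ξ, hξ, Option.some_injective _ (hn.symm.trans hn')⟩

theorem mul_mem_cone_iff (hg : g ∈ S) : (fun n => g * x n) ∈ hS.cone g ↔ x ∉ hS.cone g⁻¹ := by
  obtain ⟨s, hs⟩ := hS.exists_eventually_getElem?_word hx ht 0
  simp only [← List.head?_eq_getElem?] at hs
  simp only [cone, Set.mem_ofPred_eq, hS.head?_word_mul_left hg]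
  constructor
  · intro hne heq
    obtain ⟨n, hn, hn'⟩ := (hne.and heq).exists
    exact hn hn'
  · intro hne
    filter_upwards [hs] with n hn heq
    obtain rfl : s = g⁻¹ := Option.some_injective _ (hn.symm.trans heq)
    exact hne hs

end NearestNeighborPath

end HasUniqueReducedWords

/-! ### The free product -/

namespace FreeGp

variable {d m : ℕ}

theorem b_mul_b (j : Fin m) : (b j : FreeGp d m) * b j = 1 := by
  have h : (Multiplicative.ofAdd 1 * Multiplicative.ofAdd 1 : Multiplicative (ZMod 2)) = 1 := by
    decide
  rw [b, ← map_mul, ← map_mul, h, map_one, map_one]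

theorem b_inv (j : Fin m) : (b j : FreeGp d m)⁻¹ = b j :=
  (eq_inv_of_mul_eq_one_left (a := (b j : FreeGp d m)) (b_mul_b j)).symm

theorem a_mem_S (i : Fin d) : (a i : FreeGp d m) ∈ S d m := .inl ⟨i, rfl⟩

theorem b_mem_S (j : Fin m) : (b j : FreeGp d m) ∈ S d m := .inr (.inr ⟨j, rfl⟩)

theorem inv_mem_S (s : FreeGp d m) (hs : s ∈ S d m) : s⁻¹ ∈ S d m := by
  rcases hs with ⟨i, rfl⟩ | ⟨i, rfl⟩ | ⟨j, rfl⟩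
  · exact .inr (.inl ⟨i, rfl⟩)
  · exact .inl ⟨i, inv_inv (a i : FreeGp d m)⟩
  · rw [b_inv]; exact b_mem_S j

theorem finite_S : (S d m).Finite := by
  have hS : S d m = Set.range a ∪ (Set.range fun i => (a i)⁻¹) ∪ Set.range b := by
    ext g
    simp [S, eq_comm, or_assoc]
  rw [hS]
  exact ((Set.finite_range _).union (Set.finite_range _)).union (Set.finite_range _)

theorem eq_one_or_eq_ofAdd_one (x : Multiplicative (ZMod 2)) :
    x = 1 ∨ x = Multiplicative.ofAdd 1 := by
  revert x; decide

theorem closure_S : Subgroup.closure (S d m) = ⊤ := by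
  rw [eq_top_iff, ← Monoid.Coprod.range_inl_sup_range_inr, sup_le_iff]
  constructor
  · rw [MonoidHom.range_eq_map, ← FreeGroup.closure_range_of, MonoidHom.map_closure,
      Subgroup.closure_le]
    rintro _ ⟨_, ⟨i, rfl⟩, rfl⟩
    exact Subgroup.subset_closure (a_mem_S i)
  · rintro _ ⟨x, rfl⟩
    induction x using Monoid.CoprodI.induction_on with
    | one => rw [map_one]; exact one_mem _
    | of j x =>
      rcases eq_one_or_eq_ofAdd_one x with rfl | rfl
      · rw [map_one, map_one]; exact one_mem _
      · exact Subgroup.subset_closure (b_mem_S j)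
    | mul x y hx hy => rw [map_mul]; exact mul_mem hx hy

theorem exists_monoidHom_of_mul_self_eq_one {H : Type*} [Group H] {x : H} (hx : x * x = 1) :
    ∃ f : Multiplicative (ZMod 2) →* H, f (Multiplicative.ofAdd 1) = x := by
  have hgen (y : Multiplicative (ZMod 2)) : y ∈ Subgroup.zpowers (Multiplicative.ofAdd 1) := by
    rcases eq_one_or_eq_ofAdd_one y with rfl | rfl
    · exact one_mem _
    · exact Subgroup.mem_zpowers _
  have horder : orderOf x ∣ orderOf (Multiplicative.ofAdd (1 : ZMod 2)) := by
    rw [orderOf_ofAdd_eq_addOrderOf, ZMod.addOrderOf_one]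
    exact orderOf_dvd_of_pow_eq_one (by rw [pow_two, hx])
  exact ⟨monoidHomOfForallMemZpowers hgen horder, monoidHomOfForallMemZpowers_apply_gen hgen horder⟩

theorem exists_monoidHom {H : Type*} [Group H] (α : Fin d → H) (β : Fin m → H)
    (hβ : ∀ j, β j * β j = 1) :
    ∃ φ : FreeGp d m →* H, (∀ i, φ (a i) = α i) ∧ ∀ j, φ (b j) = β j := by
  choose f hf using fun j => exists_monoidHom_of_mul_self_eq_one (hβ j)
  refine ⟨Monoid.Coprod.lift (FreeGroup.lift α) (Monoid.CoprodI.lift f), fun i => ?_, fun j => ?_⟩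
  · simp [a]
  · simp [b, hf]

theorem hasUniqueReducedWords (d m : ℕ) : HasUniqueReducedWords (S d m) := by
  have hβ (j : Fin m) : reducedConsPerm inv_mem_S (b j : FreeGp d m) (b_mem_S j) *
      reducedConsPerm inv_mem_S (b j) (b_mem_S j) = 1 := by
    ext1 w
    have hcons := w.2.reducedCons_inv_reducedCons (b j)
    rw [b_inv j] at hcons
    exact Subtype.ext hcons
  obtain ⟨φ, ha, hb⟩ := exists_monoidHom (fun i => reducedConsPerm inv_mem_S _ (a_mem_S i))
    (fun j => reducedConsPerm inv_mem_S _ (b_mem_S j)) hβ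
  refine hasUniqueReducedWords_of_action inv_mem_S (φ := φ) (fun s hs => ?_) closure_S
  rcases hs with ⟨i, rfl⟩ | ⟨i, rfl⟩ | ⟨j, rfl⟩
  · exact ha i
  · exact (map_inv φ (a i)).trans (ha i ▸ rfl)
  · exact hb j

instance : Countable (FreeGp d m) :=
  (hasUniqueReducedWords d m).countable finite_S.countable

end FreeGp

/-! ### Markov chains on path space -/

section PathSpace

variable {E : Type*} {n : ℕ}

/-- The part of a path up to time `n`. -/
def past (n : ℕ) (y : ℕ → E) : Finset.Iic n → E := Preorder.frestrictLe n y

theorem past_surjective [Nonempty E] (n : ℕ) : Function.Surjective (past n : (ℕ → E) → _) :=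
  fun w => ⟨_, Preorder.frestrictLe_updateFinset (fun _ => Classical.arbitrary E) w⟩

theorem past_preimage_singleton (z : ℕ → E) :
    past n ⁻¹' {past n z} = {y | ∀ k ≤ n, y k = z k} := by
  ext y
  simp [past, funext_iff]

theorem measurable_past [MeasurableSpace E] (n : ℕ) : Measurable (past n : (ℕ → E) → _) :=
  Preorder.measurable_frestrictLe n

theorem measurable_shift [MeasurableSpace E] (n : ℕ) :
    Measurable fun (y : ℕ → E) k => y (n + k) :=
  measurable_pi_lambda _ fun k => measurable_pi_apply (n + k)

variable [Countable E] [MeasurableSpace E] [DiscreteMeasurableSpace E]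

theorem measurableSet_forall_le_eq (n : ℕ) (z : ℕ → E) :
    MeasurableSet {y : ℕ → E | ∀ k ≤ n, y k = z k} := by
  rw [← past_preimage_singleton]
  exact measurable_past n .of_discrete

theorem measurableSet_apply_zero_eq (x : E) : MeasurableSet {y : ℕ → E | y 0 = x} := by
  simpa using measurableSet_forall_le_eq 0 fun _ => x

theorem ext_of_forall_le_eq [Nonempty E] {μ ν : Measure (ℕ → E)} [IsFiniteMeasure μ]
    (h : ∀ (n : ℕ) (z : ℕ → E), μ {y | ∀ k ≤ n, y k = z k} = ν {y | ∀ k ≤ n, y k = z k}) :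
    μ = ν := by
  have hproj := ProbabilityTheory.isProjectiveMeasureFamily_map_restrict (P := μ)
    (X := fun k y => y k) fun k => (measurable_pi_apply k).aemeasurable
  have hμ : IsProjectiveLimit μ fun I => μ.map fun y => I.restrict y := fun I => rfl
  refine hμ.unique ((isProjectiveLimit_nat_iff hproj ν).2 fun n => ?_)
  refine Measure.ext_of_singleton fun w => ?_
  obtain ⟨z, rfl⟩ := past_surjective n w
  have hmap (ρ : Measure (ℕ → E)) : ρ.map (past n) {past n z} = ρ {y | ∀ k ≤ n, y k = z k} := by
    rw [Measure.map_apply (measurable_past n) .of_discrete, past_preimage_singleton]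
  exact (hmap ν).trans ((h n z).symm.trans (hmap μ).symm)

end PathSpace

/-- `μ` is the law on path space of the Markov chain started at `x` with transition probabilities
`K`. -/
structure IsMarkovLaw {E : Type*} [MeasurableSpace E] (K : E → E → ENNReal) (x : E)
    (μ : Measure (ℕ → E)) : Prop where
  isProbabilityMeasure : IsProbabilityMeasure μ
  start : ∀ᵐ y ∂μ, y 0 = x
  markov : ∀ (n : ℕ) (z : ℕ → E),
    μ {y | ∀ k ≤ n + 1, y k = z k} = μ {y | ∀ k ≤ n, y k = z k} * K (z n) (z (n + 1))

theorem forall_le_add_iff {n N : ℕ} {p : ℕ → Prop} :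
    (∀ k ≤ n + N, p k) ↔ (∀ k ≤ n, p k) ∧ ∀ k ≤ N, p (n + k) := by
  refine ⟨fun h => ⟨fun k hk => h k (by omega), fun k hk => h _ (by omega)⟩, fun ⟨h, h'⟩ k hk => ?_⟩
  rcases le_total k n with hkn | hkn
  · exact h k hkn
  · obtain ⟨j, rfl⟩ := Nat.exists_eq_add_of_le hkn
    exact h' j (by omega)

namespace IsMarkovLaw

variable {E : Type*} [MeasurableSpace E] {K : E → E → ENNReal} {x x₀ : E} {μ ν : Measure (ℕ → E)}
  {n : ℕ} {z : ℕ → E}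

theorem measure_forall_le_add_eq (hμ : IsMarkovLaw K x₀ μ) (hν : IsMarkovLaw K (z n) ν) (N : ℕ) :
    μ {y | ∀ k ≤ n + N, y k = z k} =
      μ {y | ∀ k ≤ n, y k = z k} * ν {y | ∀ k ≤ N, y k = z (n + k)} := by
  induction N with
  | zero =>
    have := hν.isProbabilityMeasure
    have hstart : ν {y | ∀ k ≤ 0, y k = z (n + k)} = 1 := by
      rw [← measure_univ (μ := ν)]
      exact measure_congr (eventuallyEq_univ.2 (by simpa using! hν.start))
    rw [hstart, mul_one, add_zero]
  | succ N ih => rw [← add_assoc, hμ.markov, ih, hν.markov, mul_assoc, add_assoc]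

theorem measure_forall_le_eq_inter (hμ : IsMarkovLaw K x₀ μ) (hν : IsMarkovLaw K (z n) ν) (N : ℕ)
    (w : ℕ → E) :
    μ ({y | ∀ k ≤ n, y k = z k} ∩ {y | ∀ k ≤ N, y (n + k) = w k}) =
      μ {y | ∀ k ≤ n, y k = z k} * ν {y | ∀ k ≤ N, y k = w k} := by
  by_cases hw : w 0 = z n
  · obtain ⟨z', hz', hw'⟩ : ∃ z' : ℕ → E, (∀ k ≤ n, z' k = z k) ∧ ∀ k, z' (n + k) = w k := by
      refine ⟨fun k => if k ≤ n then z k else w (k - n), fun k hk => if_pos hk, fun k => ?_⟩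
      rcases k with _ | k <;> simp [hw]
    have hD : {y : ℕ → E | ∀ k ≤ n, y k = z k} = {y | ∀ k ≤ n, y k = z' k} :=
      Set.ext fun y => forall₂_congr fun k hk => by rw [hz' k hk]
    rw [← hz' n le_rfl] at hν
    simp only [hD, ← hw', ← hμ.measure_forall_le_add_eq hν N, ← Set.ofPred_and, forall_le_add_iff]
  · have hempty : {y : ℕ → E | ∀ k ≤ n, y k = z k} ∩ {y | ∀ k ≤ N, y (n + k) = w k} = ∅ :=
      Set.eq_empty_of_forall_notMem fun y hy =>
        hw ((hy.2 0 N.zero_le).symm.trans (hy.1 n le_rfl))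
    have hnull : ν {y | ∀ k ≤ N, y k = w k} = 0 :=
      measure_mono_null (fun y hy hstart => hw ((hy 0 N.zero_le).symm.trans hstart)) hν.start
    rw [hempty, hnull, measure_empty, mul_zero]

variable [Countable E]

theorem ae_kernel_ne_zero (hμ : IsMarkovLaw K x μ) : ∀ᵐ y ∂μ, ∀ n, K (y n) (y (n + 1)) ≠ 0 := by
  have : Nonempty E := ⟨x⟩
  refine ae_all_iff.2 fun n => ?_
  have hnull :
      μ (past (n + 1) ⁻¹' {w | K (w ⟨n, by simp⟩) (w ⟨n + 1, by simp⟩) = 0}) = 0 := by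
    refine (measure_preimage_eq_zero_iff_of_countable (Set.to_countable _)).2 fun w hw => ?_
    obtain ⟨z, rfl⟩ := past_surjective (n + 1) w
    rw [past_preimage_singleton, hμ.markov]
    exact mul_eq_zero_of_right _ hw
  exact measure_eq_zero_iff_ae_notMem.1 hnull

variable [DiscreteMeasurableSpace E] {A : Set (ℕ → E)}

theorem measure_forall_le_eq_inter_shift (hμ : IsMarkovLaw K x₀ μ) (hν : IsMarkovLaw K (z n) ν)
    (hA : MeasurableSet A) :
    μ ({y | ∀ k ≤ n, y k = z k} ∩ {y | (fun k => y (n + k)) ∈ A}) =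
      μ {y | ∀ k ≤ n, y k = z k} * ν A := by
  have := hμ.isProbabilityMeasure
  have : Nonempty E := ⟨x₀⟩
  set D := {y : ℕ → E | ∀ k ≤ n, y k = z k}
  have hshift {C : Set (ℕ → E)} (hC : MeasurableSet C) :
      (μ.restrict D).map (fun y k => y (n + k)) C = μ (D ∩ {y | (fun k => y (n + k)) ∈ C}) := by
    rw [Measure.map_apply (measurable_shift n) hC, Measure.restrict_apply (measurable_shift n hC),
      Set.inter_comm]
    rfl
  have hlaw : (μ.restrict D).map (fun y k => y (n + k)) = μ D • ν :=
    ext_of_forall_le_eq fun N w => by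
      rw [hshift (measurableSet_forall_le_eq N w)]
      exact hμ.measure_forall_le_eq_inter hν N w
  rw [← hshift hA, hlaw, Measure.smul_apply, smul_eq_mul]

theorem measure_past_inter_shift (hμ : IsMarkovLaw K x₀ μ) (hν : IsMarkovLaw K x ν)
    {B : Set (Finset.Iic n → E)} (hB : ∀ w ∈ B, w ⟨n, by simp⟩ = x) (hA : MeasurableSet A) :
    μ (past n ⁻¹' B ∩ {y | (fun k => y (n + k)) ∈ A}) = μ (past n ⁻¹' B) * ν A := by
  have : Nonempty E := ⟨x⟩
  have hmeas (w : Finset.Iic n → E) : MeasurableSet (past n ⁻¹' {w}) :=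
    measurable_past n .of_discrete
  rw [← Measure.restrict_apply (measurable_past n .of_discrete),
    ← tsum_measure_preimage_singleton B.to_countable fun w _ => hmeas w,
    ← tsum_measure_preimage_singleton B.to_countable fun w _ => hmeas w, ← ENNReal.tsum_mul_right]
  refine tsum_congr fun w => ?_
  obtain ⟨w, hw⟩ := w
  obtain ⟨z, rfl⟩ := past_surjective n w
  obtain rfl : z n = x := hB _ hw
  rw [Measure.restrict_apply (hmeas _), past_preimage_singleton]
  exact hμ.measure_forall_le_eq_inter_shift hν hA

end IsMarkovLaw

section FirstVisit

variable {E : Type*} {H : Set E} {x x' : E} {A : Set (ℕ → E)}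

/-- The paths which visit `H` at time `n` for the first time, at the point `x`. -/
def firstVisitAt (H : Set E) (x : E) (n : ℕ) : Set (ℕ → E) := {y | (∀ k < n, y k ∉ H) ∧ y n = x}

/-- The paths which first visit `H` at the point `x`, and which continue from there in `A`. -/
def firstVisitThen (H : Set E) (x : E) (A : Set (ℕ → E)) : Set (ℕ → E) :=
  ⋃ n, firstVisitAt H x n ∩ {y | (fun k => y (n + k)) ∈ A}

theorem eq_of_mem_firstVisitAt (hx : x ∈ H) (hx' : x' ∈ H) {y : ℕ → E} {n n' : ℕ}
    (hy : y ∈ firstVisitAt H x n) (hy' : y ∈ firstVisitAt H x' n') : n = n' := by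
  refine le_antisymm ?_ ?_
  · exact not_lt.1 fun hlt => hy.1 n' hlt (hy'.2 ▸ hx')
  · exact not_lt.1 fun hlt => hy'.1 n hlt (hy.2 ▸ hx)

theorem disjoint_firstVisitThen (hx : x ∈ H) (hx' : x' ∈ H) (hne : x ≠ x') (A A' : Set (ℕ → E)) :
    Disjoint (firstVisitThen H x A) (firstVisitThen H x' A') := by
  simp only [firstVisitThen, Set.disjoint_left, Set.mem_iUnion, not_exists]
  rintro y ⟨n, hy, -⟩ n' ⟨hy', -⟩
  obtain rfl := eq_of_mem_firstVisitAt hx hx' hy hy'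
  exact hne (hy.2.symm.trans hy'.2)

theorem exists_mem_firstVisitAt {y : ℕ → E} (hy : ∃ n, y n ∈ H) :
    ∃ n, y n ∈ H ∧ y ∈ firstVisitAt H (y n) n := by
  classical
  exact ⟨Nat.find hy, Nat.find_spec hy, fun k hk => Nat.find_min hy hk, rfl⟩

theorem firstVisitAt_eq_preimage_past (H : Set E) (x : E) (n : ℕ) :
    firstVisitAt H x n = past n ⁻¹' {w | (∀ k, k.1 < n → w k ∉ H) ∧ w ⟨n, by simp⟩ = x} :=
  Set.ext fun _ => and_congr_left'
    ⟨fun h k hk => h k hk, fun h k hk => h ⟨k, by simpa using hk.le⟩ hk⟩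

variable [Countable E] [MeasurableSpace E] [DiscreteMeasurableSpace E]

theorem measurableSet_firstVisitAt (H : Set E) (x : E) (n : ℕ) :
    MeasurableSet (firstVisitAt H x n) := by
  rw [firstVisitAt_eq_preimage_past]
  exact measurable_past n .of_discrete

theorem measurableSet_firstVisitThen (H : Set E) (x : E) (hA : MeasurableSet A) :
    MeasurableSet (firstVisitThen H x A) :=
  .iUnion fun n => (measurableSet_firstVisitAt H x n).inter (measurable_shift n hA)

theorem IsMarkovLaw.measure_firstVisitThen {K : E → E → ENNReal} {x₀ : E} {μ ν : Measure (ℕ → E)}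
    (hμ : IsMarkovLaw K x₀ μ) (hν : IsMarkovLaw K x ν) (hx : x ∈ H) (hA : MeasurableSet A) :
    μ (firstVisitThen H x A) = μ (firstVisitThen H x Set.univ) * ν A := by
  have hmeas := measurableSet_firstVisitAt H x
  have hdisj : Pairwise (Function.onFun Disjoint (firstVisitAt H x)) := fun n n' hn =>
    Set.disjoint_left.2 fun y hy hy' => hn (eq_of_mem_firstVisitAt hx hx hy hy')
  have hdisj' : Pairwise (Function.onFun Disjoint
      fun n => firstVisitAt H x n ∩ {y | (fun k => y (n + k)) ∈ A}) :=
    hdisj.mono fun n n' h => h.mono Set.inter_subset_left Set.inter_subset_left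
  simp only [firstVisitThen, Set.mem_univ, Set.ofPred_true, Set.inter_univ]
  rw [measure_iUnion hdisj' fun n => (hmeas n).inter (measurable_shift n hA),
    measure_iUnion hdisj hmeas, ← ENNReal.tsum_mul_right]
  refine tsum_congr fun n => ?_
  rw [firstVisitAt_eq_preimage_past]
  exact hμ.measure_past_inter_shift hν (fun w hw => hw.2) hA

end FirstVisit

/-! ### Invertibility of `1 - M` -/

section LinearAlgebra

open scoped Matrix

variable {ι κ : Type*} [Fintype ι] {R : Type*}

theorem isUnit_one_sub_of_tendsto_pow [DecidableEq ι] [Field R] [TopologicalSpace R]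
    [IsTopologicalRing R] [T1Space R] {M : Matrix ι ι R}
    (hM : Tendsto (fun k => M ^ k) atTop (nhds 0)) : IsUnit (1 - M) := by
  have hdet : Tendsto (fun k => (1 - M ^ k).det) atTop (nhds 1) := by
    have hcont : Continuous fun A : Matrix ι ι R => (1 - A).det :=
      (continuous_const.sub continuous_id).matrix_det
    simpa using! (hcont.tendsto 0).comp hM
  obtain ⟨k, hk⟩ := (hdet.eventually_ne one_ne_zero).exists
  rw [← mul_neg_geom_sum, Matrix.det_mul] at hk
  exact (Matrix.isUnit_iff_isUnit_det _).2 (left_ne_zero_of_mul hk).isUnit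

theorem mulVec_le_mulVec_of_nonneg [Semiring R] [PartialOrder R] [IsOrderedRing R]
    {M : Matrix κ ι R} (hM : ∀ i j, 0 ≤ M i j) {x y : ι → R} (hxy : x ≤ y) : M *ᵥ x ≤ M *ᵥ y :=
  fun i => Finset.sum_le_sum fun j _ => mul_le_mul_of_nonneg_left (hxy j) (hM i j)

theorem isUnit_one_sub_of_mulVec_le [DecidableEq ι] [Field R] [LinearOrder R]
    [IsStrictOrderedRing R] [TopologicalSpace R] [OrderTopology R] {M : Matrix ι ι R}
    (hM : ∀ i j, 0 ≤ M i j) {f : ℕ → ι → R} (h0 : 1 ≤ f 0) (hf : ∀ k, M *ᵥ f k ≤ f (k + 1))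
    (hlim : Tendsto f atTop (nhds 0)) : IsUnit (1 - M) := by
  have hpow (k : ℕ) : ∀ i j, 0 ≤ (M ^ k) i j := by
    induction k with
    | zero => intro i j; rw [pow_zero, Matrix.one_apply]; split_ifs <;> simp
    | succ k ih =>
      intro i j
      rw [pow_succ, Matrix.mul_apply]
      exact Finset.sum_nonneg fun l _ => mul_nonneg (ih i l) (hM l j)
  have hrow (k : ℕ) : M ^ k *ᵥ 1 ≤ f k := by
    induction k with
    | zero => simpa using h0
    | succ k ih =>
      rw [pow_succ', ← Matrix.mulVec_mulVec]
      exact (mulVec_le_mulVec_of_nonneg hM ih).trans (hf k)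
  have hentry (k : ℕ) (i j : ι) : (M ^ k) i j ≤ f k i := by
    refine le_trans ?_ (hrow k i)
    simp only [Matrix.mulVec, dotProduct, Pi.one_apply, mul_one]
    exact Finset.single_le_sum (f := (M ^ k) i) (fun l _ => hpow k i l) (Finset.mem_univ j)
  refine isUnit_one_sub_of_tendsto_pow (tendsto_pi_nhds.2 fun i => tendsto_pi_nhds.2 fun j => ?_)
  exact tendsto_of_tendsto_of_tendsto_of_le_of_le tendsto_const_nhds (tendsto_pi_nhds.1 hlim i)
    (fun k => hpow k i j) fun k => hentry k i j

theorem one_sub_mul_mulVec_one_sub [DecidableEq ι] [Fintype κ] [Ring R] {A : Matrix κ ι R}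
    {B : Matrix ι κ R} {x : κ → R} {y : ι → R} (hx : x = A *ᵥ (1 - y)) (hy : y = B *ᵥ (1 - x)) :
    (1 - B * A) *ᵥ (1 - y) = 1 - B *ᵥ 1 := by
  rw [Matrix.sub_mulVec, Matrix.one_mulVec, ← Matrix.mulVec_mulVec, ← hx]
  nth_rewrite 1 [hy]
  rw [Matrix.mulVec_sub]
  abel

end LinearAlgebra

/-! ### The colored walk -/

namespace ColoredWalk

open scoped Matrix

section Visits

variable {G : Type*} {r : ℕ}

/-- The trajectories which first visit `g` with color `v`, and which continue from there in `A`. -/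
def hitThen (g : G) (v : Fin r) (A : Set (ℕ → G × Fin r)) : Set (ℕ → G × Fin r) :=
  firstVisitThen {x | x.1 = g} (g, v) A

theorem hitThen_eq_inter {g : G} {v : Fin r} {A : Set (ℕ → G × Fin r)}
    (hA : ∀ y n, (fun k => y (n + k)) ∈ A ↔ y ∈ A) :
    hitThen g v A = A ∩ hitThen g v Set.univ := by
  ext y
  simp [hitThen, firstVisitThen, hA, and_comm]

theorem iUnion_hitThen_univ (g : G) :
    ⋃ v : Fin r, hitThen g v Set.univ = {y | ∃ n, (y n).1 = g} := by
  ext y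
  simp only [hitThen, firstVisitThen, Set.mem_univ, Set.ofPred_true, Set.inter_univ,
    Set.mem_iUnion, Set.mem_ofPred_eq]
  constructor
  · rintro ⟨v, n, hn⟩
    exact ⟨n, congrArg Prod.fst hn.2⟩
  · intro hvisit
    obtain ⟨n, hn, hfirst⟩ := exists_mem_firstVisitAt (H := {x : G × Fin r | x.1 = g}) hvisit
    exact ⟨(y n).2, n, hfirst.1, Prod.ext hn rfl⟩

/-- The trajectories which are at `g`, with any color, at some time `n ≥ k`. -/
def lateVisits (k : ℕ) (g : G) : Set (ℕ → G × Fin r) := {y | ∃ n ≥ k, (y n).1 = g}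

variable [MeasurableSpace G]

theorem measurableSet_hitThen [Countable G] [DiscreteMeasurableSpace G] (g : G) (v : Fin r)
    {A : Set (ℕ → G × Fin r)} (hA : MeasurableSet A) : MeasurableSet (hitThen g v A) :=
  measurableSet_firstVisitThen _ _ hA

theorem measurableSet_lateVisits [Countable G] [DiscreteMeasurableSpace G] (k : ℕ) (g : G) :
    MeasurableSet (lateVisits k g : Set (ℕ → G × Fin r)) := by
  have hunion : lateVisits k g =
      ⋃ n, ⋃ (_ : n ≥ k), (fun y : ℕ → G × Fin r => y n) ⁻¹' {x | x.1 = g} := by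
    ext
    simp [lateVisits]
  rw [hunion]
  exact .iUnion fun n => .iUnion fun _ => measurable_pi_apply n .of_discrete

variable (L : Fin r → Measure (ℕ → G × Fin r))

/-- The matrix `q_g` of a family of laws on path space: the `(u, v)` entry is the probability under
`L u` that `g` is visited, for the first time with color `v`. -/
noncomputable def hitMatrix (g : G) : Matrix (Fin r) (Fin r) ℝ :=
  Matrix.of fun u v => (L u).real (hitThen g v Set.univ)

theorem hitMatrix_nonneg (g : G) (u v : Fin r) : 0 ≤ hitMatrix L g u v := measureReal_nonneg

/-- The probability of a visit to `g` at some time `n ≥ k`, as a function of the initial color. -/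
noncomputable def lateVisitProb (k : ℕ) (g : G) : Fin r → ℝ := fun u => (L u).real (lateVisits k g)

end Visits

section Walk

variable {G : Type*} [Group G] {r : ℕ} {p : G → Matrix (Fin r) (Fin r) ℝ} {S : Set G}

/-- The transition probabilities of the colored walk, as a function on pairs of states. -/
noncomputable def kernel (p : G → Matrix (Fin r) (Fin r) ℝ) (x y : G × Fin r) : ENNReal :=
  ENNReal.ofReal (p (x.1⁻¹ * y.1) x.2 y.2)

/-- The left translate of a trajectory by a group element. -/
def translate (g : G) (y : ℕ → G × Fin r) : ℕ → G × Fin r := fun n => (g * (y n).1, (y n).2)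

/-- The trajectories whose position has a reduced word eventually beginning with `g`. -/
def pathCone (hS : HasUniqueReducedWords S) (g : G) : Set (ℕ → G × Fin r) :=
  {y | (fun n => (y n).1) ∈ hS.cone g}

theorem shift_mem_pathCone_iff (hS : HasUniqueReducedWords S) (g : G) (y : ℕ → G × Fin r) (n : ℕ) :
    (fun k => y (n + k)) ∈ pathCone hS g ↔ y ∈ pathCone hS g :=
  hS.shift_mem_cone_iff (fun k => (y k).1) n

variable [MeasurableSpace G]

/-- The probability that the limit begins with the letter `g`, as a function of the initial
color. -/
noncomputable def firstLetterProb (hS : HasUniqueReducedWords S)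
    (L : Fin r → Measure (ℕ → G × Fin r)) (g : G) : Fin r → ℝ :=
  fun u => (L u).real (pathCone hS g)

theorem measurableSet_pathCone [DiscreteMeasurableSpace G] (hS : HasUniqueReducedWords S) (g : G) :
    MeasurableSet (pathCone hS g : Set (ℕ → G × Fin r)) :=
  measurable_pi_lambda (fun (y : ℕ → G × Fin r) n => (y n).1)
    (fun n => (measurable_pi_apply n).fst) (hS.measurableSet_cone g)

theorem one_le_lateVisitProb_zero_one {L : Fin r → Measure (ℕ → G × Fin r)}
    (hL : ∀ u, IsMarkovLaw (kernel p) (1, u) (L u)) : 1 ≤ lateVisitProb L 0 1 := fun u => by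
  have := (hL u).isProbabilityMeasure
  rw [Pi.one_apply, ← probReal_univ (μ := L u)]
  refine ENNReal.toReal_mono (measure_ne_top _ _) (measure_mono_ae ?_)
  filter_upwards [(hL u).start] with y hy _
  exact ⟨0, le_rfl, by rw [hy]⟩

variable [Countable G]

theorem ae_step_mem {x : G × Fin r} {μ : Measure (ℕ → G × Fin r)}
    (hμ : IsMarkovLaw (kernel p) x μ) (hnn : ∀ g, g ∉ S → p g = 0) :
    ∀ᵐ y ∂μ, ∀ n, (y n).1⁻¹ * (y (n + 1)).1 ∈ S := by
  filter_upwards [hμ.ae_kernel_ne_zero] with y hy n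
  by_contra hn
  exact hy n (by simp [kernel, hnn _ hn])

variable [DiscreteMeasurableSpace G]

theorem measurable_translate (g : G) : Measurable (translate g : (ℕ → G × Fin r) → _) :=
  measurable_pi_lambda _ fun n =>
    (Measurable.of_discrete (f := fun x : G × Fin r => (g * x.1, x.2))).comp (measurable_pi_apply n)

theorem isMarkovLaw_map_translate {h : G} {v : Fin r} {μ : Measure (ℕ → G × Fin r)}
    (hμ : IsMarkovLaw (kernel p) (h, v) μ) (g : G) :
    IsMarkovLaw (kernel p) (g * h, v) (μ.map (translate g)) := by
  have := hμ.isProbabilityMeasure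
  have hmeas := measurable_translate (r := r) g
  have hcyl (n : ℕ) (z : ℕ → G × Fin r) : μ.map (translate g) {y | ∀ k ≤ n, y k = z k} =
      μ {y | ∀ k ≤ n, y k = translate g⁻¹ z k} := by
    rw [Measure.map_apply hmeas (measurableSet_forall_le_eq n z)]
    simp [translate, Prod.ext_iff, eq_inv_mul_iff_mul_eq]
  refine ⟨Measure.isProbabilityMeasure_map hmeas.aemeasurable, ?_, fun n z => ?_⟩
  · refine (ae_map_iff hmeas.aemeasurable (measurableSet_apply_zero_eq _)).2 ?_
    filter_upwards [hμ.start] with y hy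
    simp [translate, hy]
  · rw [hcyl, hcyl, hμ.markov]
    simp [kernel, translate, mul_assoc]

variable {L : Fin r → Measure (ℕ → G × Fin r)}

section Hitting

variable (hL : ∀ u, IsMarkovLaw (kernel p) (1, u) (L u))
include hL

theorem measureReal_hitThen (g : G) (u v : Fin r) {A : Set (ℕ → G × Fin r)}
    (hA : MeasurableSet A) :
    (L u).real (hitThen g v A) = hitMatrix L g u v * (L v).real (translate g ⁻¹' A) := by
  have hLg : IsMarkovLaw (kernel p) (g, v) ((L v).map (translate g)) := by
    simpa using isMarkovLaw_map_translate (hL v) g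
  have hmarkov := (hL u).measure_firstVisitThen hLg (H := {x : G × Fin r | x.1 = g}) rfl hA
  rw [Measure.map_apply (measurable_translate g) hA] at hmarkov
  simpa using! congrArg ENNReal.toReal hmarkov

theorem hitMatrix_mulVec (g : G) {A : Set (ℕ → G × Fin r)} (hA : MeasurableSet A) :
    hitMatrix L g *ᵥ (fun v => (L v).real (translate g ⁻¹' A)) =
      fun u => (L u).real (⋃ v, hitThen g v A) := by
  funext u
  have := (hL u).isProbabilityMeasure
  have hdisj : Pairwise (Function.onFun Disjoint fun v => hitThen g v A) := fun v w hvw =>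
    disjoint_firstVisitThen (H := {x : G × Fin r | x.1 = g}) rfl rfl
      (fun h => hvw (congrArg Prod.snd h)) A A
  rw [measureReal_iUnion_fintype hdisj fun v => measurableSet_hitThen g v hA]
  simp only [measureReal_hitThen hL g u _ hA]
  rfl

/-- The index increases because the walk starts at `1`, so that the first visit to `g ≠ 1` takes at
least one unit of time. -/
theorem hitMatrix_mulVec_lateVisitProb_le {g : G} (hg : g ≠ 1) (k : ℕ) (h : G) :
    hitMatrix L g *ᵥ lateVisitProb L k h ≤ lateVisitProb L (k + 1) (g * h) := by
  have htranslate : lateVisits k h = translate (r := r) g ⁻¹' lateVisits k (g * h) := by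
    ext
    simp [lateVisits, translate]
  have hprob : lateVisitProb L k h =
      fun v => (L v).real (translate g ⁻¹' lateVisits k (g * h)) := by
    rw [← htranslate]
    rfl
  rw [hprob, hitMatrix_mulVec hL g (measurableSet_lateVisits k (g * h))]
  intro u
  have := (hL u).isProbabilityMeasure
  refine ENNReal.toReal_mono (measure_ne_top _ _) (measure_mono_ae ?_)
  filter_upwards [(hL u).start] with y hstart hy
  obtain ⟨v, hv⟩ := Set.mem_iUnion.1 hy
  obtain ⟨n, hfirst, j, hj, hjh⟩ := Set.mem_iUnion.1 hv
  have hn : n ≠ 0 := by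
    rintro rfl
    exact hg (congrArg Prod.fst (hfirst.2.symm.trans hstart))
  exact ⟨n + j, by omega, hjh⟩

theorem tendsto_lateVisitProb {g : G}
    (ht : ∀ u, ∀ᵐ y ∂L u, ∀ᶠ n in atTop, (y n).1 ≠ g) :
    Tendsto (fun k => lateVisitProb L k g) atTop (nhds 0) := by
  refine tendsto_pi_nhds.2 fun u => ?_
  have := (hL u).isProbabilityMeasure
  have hnull : L u (⋂ k, lateVisits k g) = 0 := by
    refine measure_eq_zero_iff_ae_notMem.2 ?_
    filter_upwards [ht u] with y hy hmem
    obtain ⟨k, hk⟩ := eventually_atTop.1 hy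
    obtain ⟨n, hn, hng⟩ := Set.mem_iInter.1 hmem k
    exact hk n hn hng
  have hlim := tendsto_measure_iInter_atTop (μ := L u)
    (fun k => (measurableSet_lateVisits k g).nullMeasurableSet)
    (fun k l hkl y ⟨n, hn, hng⟩ => ⟨n, le_trans hkl hn, hng⟩) ⟨0, measure_ne_top _ _⟩
  rw [hnull] at hlim
  exact (ENNReal.tendsto_toReal ENNReal.zero_ne_top).comp hlim

theorem isUnit_one_sub_hitMatrix_mul (ht : ∀ u, ∀ᵐ y ∂L u, ∀ᶠ n in atTop, (y n).1 ≠ 1) {g : G}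
    (hg : g ≠ 1) : IsUnit (1 - hitMatrix L g⁻¹ * hitMatrix L g) := by
  have hnonneg (u v : Fin r) : 0 ≤ (hitMatrix L g⁻¹ * hitMatrix L g) u v := by
    rw [Matrix.mul_apply]
    exact Finset.sum_nonneg fun w _ =>
      mul_nonneg (hitMatrix_nonneg L _ u w) (hitMatrix_nonneg L _ w v)
  have hstep (k : ℕ) : (hitMatrix L g⁻¹ * hitMatrix L g) *ᵥ lateVisitProb L (2 * k) 1 ≤
      lateVisitProb L (2 * (k + 1)) 1 :=
    calc (hitMatrix L g⁻¹ * hitMatrix L g) *ᵥ lateVisitProb L (2 * k) 1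
        = hitMatrix L g⁻¹ *ᵥ (hitMatrix L g *ᵥ lateVisitProb L (2 * k) 1) :=
          (Matrix.mulVec_mulVec _ _ _).symm
      _ ≤ hitMatrix L g⁻¹ *ᵥ lateVisitProb L (2 * k + 1) (g * 1) :=
          mulVec_le_mulVec_of_nonneg (hitMatrix_nonneg L _)
            (hitMatrix_mulVec_lateVisitProb_le hL hg _ _)
      _ ≤ lateVisitProb L (2 * k + 1 + 1) (g⁻¹ * (g * 1)) :=
          hitMatrix_mulVec_lateVisitProb_le hL (inv_ne_one.2 hg) _ _
      _ = lateVisitProb L (2 * (k + 1)) 1 := by rw [inv_mul_cancel_left]; rfl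
  exact isUnit_one_sub_of_mulVec_le hnonneg (one_le_lateVisitProb_zero_one hL) hstep
    ((tendsto_lateVisitProb hL ht).comp (tendsto_id.const_mul_atTop' two_pos))

end Hitting

section FirstLetter

variable (hS : HasUniqueReducedWords S) (hL : ∀ u, IsMarkovLaw (kernel p) (1, u) (L u))
  (hnn : ∀ g, g ∉ S → p g = 0) (ht : ∀ u, ∀ᵐ y ∂L u, ∀ g, ∀ᶠ n in atTop, (y n).1 ≠ g) {g : G}
include hL hnn ht

theorem measureReal_translate_preimage_pathCone (hg : g ∈ S) (v : Fin r) :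
    (L v).real (translate g ⁻¹' pathCone hS g) = 1 - firstLetterProb hS L g⁻¹ v := by
  have := (hL v).isProbabilityMeasure
  rw [firstLetterProb, ← probReal_compl_eq_one_sub (measurableSet_pathCone hS g⁻¹)]
  refine measureReal_congr ?_
  filter_upwards [ae_step_mem (hL v) hnn, ht v] with y hstep htr
  exact propext (hS.mul_mem_cone_iff hstep htr hg)

theorem measureReal_hitThen_pathCone (hg : g ∈ S) (u v : Fin r) :
    (L u).real (hitThen g v (pathCone hS g)) =
      hitMatrix L g u v * (1 - firstLetterProb hS L g⁻¹ v) := by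
  rw [measureReal_hitThen hL g u v (measurableSet_pathCone hS g),
    measureReal_translate_preimage_pathCone hS hL hnn ht hg]

theorem firstLetterProb_eq_hitMatrix_mulVec (hg : g ∈ S) :
    firstLetterProb hS L g = hitMatrix L g *ᵥ (1 - firstLetterProb hS L g⁻¹) := by
  have hcone : (1 - firstLetterProb hS L g⁻¹) =
      fun v => (L v).real (translate g ⁻¹' pathCone hS g) :=
    funext fun v => (measureReal_translate_preimage_pathCone hS hL hnn ht hg v).symm
  rw [hcone, hitMatrix_mulVec hL g (measurableSet_pathCone hS g)]
  simp only [hitThen_eq_inter (shift_mem_pathCone_iff hS g), ← Set.inter_iUnion,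
    iUnion_hitThen_univ]
  funext u
  refine measureReal_congr ?_
  filter_upwards [ae_step_mem (hL u) hnn, (hL u).start] with y hstep hstart
  refine propext ⟨fun hy => ⟨hy, ?_⟩, And.left⟩
  obtain ⟨n, hn⟩ := Eventually.exists (f := atTop) hy
  exact hS.exists_eq_of_head?_word hstep (congrArg Prod.fst hstart) hn

theorem one_sub_firstLetterProb_inv (hg : g ∈ S) :
    1 - firstLetterProb hS L g⁻¹ =
      (1 - hitMatrix L g⁻¹ * hitMatrix L g)⁻¹ *ᵥ (1 - hitMatrix L g⁻¹ *ᵥ 1) := by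
  have hunit := isUnit_one_sub_hitMatrix_mul hL (fun u => (ht u).mono fun y hy => hy 1)
    (hS.ne_one_of_mem hg)
  have hinv := firstLetterProb_eq_hitMatrix_mulVec hS hL hnn ht (hS.inv_mem hg)
  rw [inv_inv] at hinv
  rw [← one_sub_mul_mulVec_one_sub (firstLetterProb_eq_hitMatrix_mulVec hS hL hnn ht hg) hinv,
    Matrix.mulVec_mulVec, Matrix.nonsing_inv_mul _ ((Matrix.isUnit_iff_isUnit_det _).1 hunit),
    Matrix.one_mulVec]

end FirstLetter

end Walk

section Transfer

variable {G : Type*} {r : ℕ} {Ω : Type*}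

theorem hitTime_eq_coe_iff (X : ℕ → Ω → G × Fin r) (A : Set (G × Fin r)) (ω : Ω) (n : ℕ) :
    hitTime X A ω = n ↔ (∀ k < n, X k ω ∉ A) ∧ X n ω ∈ A := by
  have hle (k : ℕ) (hk : X k ω ∈ A) : hitTime X A ω ≤ k := sInf_le ⟨k, hk, rfl⟩
  constructor
  · intro h
    have hne : ((fun n : ℕ => (n : ℕ∞)) '' {n | X n ω ∈ A}).Nonempty := by
      by_contra hempty
      rw [Set.not_nonempty_iff_eq_empty] at hempty
      simp [hitTime, hempty] at h
    obtain ⟨k, hk, hkinf⟩ := csInf_mem hne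
    obtain rfl : k = n := ENat.natCast_inj.1 (hkinf.trans h)
    exact ⟨fun j hj hjA => (Nat.cast_le.1 (h ▸ hle j hjA)).not_gt hj, hk⟩
  · rintro ⟨hbefore, hn⟩
    refine le_antisymm (hle n hn) (le_sInf ?_)
    rintro _ ⟨k, hk, rfl⟩
    exact Nat.cast_le.2 (not_lt.1 fun hkn => hbefore k hkn hk)

theorem exists_tau_eq_iff (X : ℕ → Ω → G × Fin r) (g : G) (v : Fin r) (ω : Ω) :
    (∃ n : ℕ, tau X g ω = n ∧ X n ω = (g, v)) ↔ (fun n => X n ω) ∈ hitThen g v Set.univ := by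
  simp only [tau, hitTime_eq_coe_iff, hitThen, firstVisitThen, firstVisitAt, Set.mem_univ,
    Set.ofPred_true, Set.inter_univ, Set.mem_iUnion, Set.mem_ofPred_eq]
  exact exists_congr fun n => ⟨fun h => ⟨h.1.1, h.2⟩, fun h => ⟨⟨h.1, congrArg Prod.fst h.2⟩, h.2⟩⟩

theorem tau_eq_hitTime_iff (X : ℕ → Ω → G × Fin r) (g : G) (v : Fin r) (ω : Ω) :
    (tau X g ω < ⊤ ∧ tau X g ω = hitTime X {(g, v)} ω) ↔
      (fun n => X n ω) ∈ hitThen g v Set.univ := by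
  rw [← exists_tau_eq_iff]
  constructor
  · rintro ⟨hfin, heq⟩
    obtain ⟨n, hn⟩ := ENat.ne_top_iff_exists.1 hfin.ne
    exact ⟨n, hn.symm, ((hitTime_eq_coe_iff _ _ _ _).1 (hn.trans heq).symm).2⟩
  · rintro ⟨n, hn, hX⟩
    have hbefore := ((hitTime_eq_coe_iff _ _ _ _).1 hn).1
    refine ⟨hn ▸ ENat.natCast_lt_top n, hn.trans (Eq.symm ((hitTime_eq_coe_iff _ _ _ _).2 ?_))⟩
    exact ⟨fun k hk hkX => hbefore k hk (congrArg Prod.fst hkX), hX⟩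

variable [MeasurableSpace Ω]

theorem ae_eventually_fst_ne [Countable G] {ℙ : Fin r → Measure Ω} {X : ℕ → Ω → G × Fin r}
    (htr : IsTransient ℙ X) (u : Fin r) : ∀ᵐ ω ∂ℙ u, ∀ g, ∀ᶠ n in atTop, (X n ω).1 ≠ g := by
  refine ae_all_iff.2 fun g => ?_
  filter_upwards [ae_all_iff.2 fun v => htr u (g, v)] with ω hω
  filter_upwards [eventually_all.2 hω] with n hn hg
  exact hn (X n ω).2 (Prod.ext hg rfl)

theorem sum_mul_one_sub_dmat (ℙ : Fin r → Measure Ω) (X : ℕ → Ω → G × Fin r)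
    (M : Matrix (Fin r) (Fin r) ℝ) (g : G) (v : Fin r) :
    ∑ w, (M * (1 - dmat ℙ X g)) v w = (M *ᵥ (1 - q ℙ X g *ᵥ 1)) v := by
  have hdmat : (1 - dmat ℙ X g) *ᵥ 1 = 1 - q ℙ X g *ᵥ 1 := by
    rw [Matrix.sub_mulVec, Matrix.one_mulVec]
    congr 1
    ext u
    rw [dmat, Matrix.mulVec_diagonal, Pi.one_apply, mul_one]
    simp only [Matrix.mulVec, dotProduct, Pi.one_apply, mul_one]
  rw [← hdmat, Matrix.mulVec_mulVec]
  simp only [Matrix.mulVec, dotProduct, Pi.one_apply, mul_one]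

variable [Group G]

/-- The matrix `μ_g` for a walk on an arbitrary group, the limit being an infinite reduced word in
the alphabet `S`. -/
noncomputable def limitMatrix (S : Set G) (ℙ : Fin r → Measure Ω) (X : ℕ → Ω → G × Fin r) (g : G) :
    Matrix (Fin r) (Fin r) ℝ :=
  Matrix.of fun u v => (ℙ u).real
    {ω | (∃ ξ, IsBoundaryLimit S (fun n => (X n ω).1) ξ ∧ ξ 0 = g) ∧
      ∃ n : ℕ, tau X g ω = n ∧ X n ω = (g, v)}

variable [Countable G] [MeasurableSpace G] {p : G → Matrix (Fin r) (Fin r) ℝ}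

/-- The law of the trajectory of the walk, for each initial color. -/
noncomputable def pathLaw (ℙ : Fin r → Measure Ω) (X : ℕ → Ω → G × Fin r) (u : Fin r) :
    Measure (ℕ → G × Fin r) :=
  (ℙ u).map fun ω n => X n ω

theorem measurable_path {ℙ : Measure Ω} {X : ℕ → Ω → G × Fin r} {u : Fin r}
    (hX : IsColoredWalk p u ℙ X) : Measurable fun ω n => X n ω :=
  measurable_pi_lambda _ fun n => measurable_to_countable' fun x => hX.measurable n x

variable [DiscreteMeasurableSpace G] {S : Set G} {ℙ : Fin r → Measure Ω} {X : ℕ → Ω → G × Fin r}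
  (hX : ∀ u, IsColoredWalk p u (ℙ u) X)
include hX

theorem isMarkovLaw_pathLaw (u : Fin r) : IsMarkovLaw (kernel p) (1, u) (pathLaw ℙ X u) := by
  have := (hX u).isProbabilityMeasure
  have hpath := measurable_path (hX u)
  have hcyl (n : ℕ) (z : ℕ → G × Fin r) :
      pathLaw ℙ X u {y | ∀ k ≤ n, y k = z k} = ℙ u {ω | ∀ k ≤ n, X k ω = z k} :=
    Measure.map_apply hpath (measurableSet_forall_le_eq n z)
  refine ⟨Measure.isProbabilityMeasure_map hpath.aemeasurable, ?_, fun n z => ?_⟩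
  · exact (ae_map_iff hpath.aemeasurable (measurableSet_apply_zero_eq _)).2 (hX u).start
  · rw [hcyl, hcyl, ← ofReal_measureReal, (hX u).markov, ENNReal.ofReal_mul measureReal_nonneg,
      ofReal_measureReal]
    rfl

theorem ae_step_mem_path (hnn : ∀ g, g ∉ S → p g = 0) (u : Fin r) :
    ∀ᵐ ω ∂ℙ u, ∀ n, (X n ω).1⁻¹ * (X (n + 1) ω).1 ∈ S :=
  ae_of_ae_map (measurable_path (hX u)).aemeasurable (ae_step_mem (isMarkovLaw_pathLaw hX u) hnn)

theorem ae_pathLaw_eventually_fst_ne (htr : IsTransient ℙ X) (u : Fin r) :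
    ∀ᵐ y ∂pathLaw ℙ X u, ∀ g, ∀ᶠ n in atTop, (y n).1 ≠ g := by
  refine ae_all_iff.2 fun g => ?_
  have hmeas : MeasurableSet {y : ℕ → G × Fin r | ∀ᶠ n in atTop, (y n).1 ≠ g} := by
    have hunion : {y : ℕ → G × Fin r | ∀ᶠ n in atTop, (y n).1 ≠ g} =
        ⋃ k, (lateVisits k g)ᶜ := by
      ext
      simp [lateVisits, eventually_atTop]
    rw [hunion]
    exact .iUnion fun k => (measurableSet_lateVisits k g).compl
  refine (ae_map_iff (measurable_path (hX u)).aemeasurable hmeas).2 ?_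
  exact (ae_eventually_fst_ne htr u).mono fun ω hω => hω g

theorem q_eq_hitMatrix (g : G) : q ℙ X g = hitMatrix (pathLaw ℙ X) g := by
  ext u v
  simp only [q, tau_eq_hitTime_iff]
  exact (map_measureReal_apply (measurable_path (hX u))
    (measurableSet_hitThen g v .univ)).symm

theorem limitMatrix_apply (hS : HasUniqueReducedWords S) (hnn : ∀ g, g ∉ S → p g = 0)
    (htr : IsTransient ℙ X) (g : G) (u v : Fin r) :
    limitMatrix S ℙ X g u v = (pathLaw ℙ X u).real (hitThen g v (pathCone hS g)) := by
  rw [pathLaw, map_measureReal_apply (measurable_path (hX u))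
    (measurableSet_hitThen g v (measurableSet_pathCone hS g)),
    hitThen_eq_inter (shift_mem_pathCone_iff hS g)]
  refine measureReal_congr ?_
  filter_upwards [ae_step_mem_path hX hnn u, ae_eventually_fst_ne htr u] with ω hstep hne
  exact propext (and_congr (hS.exists_isBoundaryLimit_zero_eq_iff hstep hne)
    (exists_tau_eq_iff X g v ω))

end Transfer

end ColoredWalk

theorem mainTheorem9_general {G : Type*} [Group G] [Countable G] {S : Set G}
    (hS : HasUniqueReducedWords S) {r : ℕ} {Ω : Type*} [MeasurableSpace Ω]
    (p : G → Matrix (Fin r) (Fin r) ℝ) (hnn : ∀ g, g ∉ S → p g = 0)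
    (ℙ : Fin r → Measure Ω) (X : ℕ → Ω → G × Fin r)
    (hX : ∀ u, IsColoredWalk p u (ℙ u) X) (htr : ColoredWalk.IsTransient ℙ X) :
    (∀ u, ∀ᵐ ω ∂ℙ u, ∃! ξ : ℕ → G, IsBoundaryLimit S (fun n => (X n ω).1) ξ) ∧
    ∀ g ∈ S,
      IsUnit (1 - ColoredWalk.q ℙ X g⁻¹ * ColoredWalk.q ℙ X g) ∧
      ∀ u v, ColoredWalk.limitMatrix S ℙ X g u v =
        ColoredWalk.q ℙ X g u v *
          ∑ w, ((1 - ColoredWalk.q ℙ X g⁻¹ * ColoredWalk.q ℙ X g)⁻¹ *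
            (1 - ColoredWalk.dmat ℙ X g⁻¹)) v w := by
  let : MeasurableSpace G := ⊤
  have hL := ColoredWalk.isMarkovLaw_pathLaw hX
  have ht := ColoredWalk.ae_pathLaw_eventually_fst_ne hX htr
  refine ⟨fun u => ?_, fun g hg => ⟨?_, fun u v => ?_⟩⟩
  · filter_upwards [ColoredWalk.ae_step_mem_path hX hnn u, ColoredWalk.ae_eventually_fst_ne htr u]
      with ω hstep hne
    exact hS.existsUnique_isBoundaryLimit hstep hne
  · rw [ColoredWalk.q_eq_hitMatrix hX, ColoredWalk.q_eq_hitMatrix hX]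
    exact ColoredWalk.isUnit_one_sub_hitMatrix_mul hL (fun u => (ht u).mono fun y hy => hy 1)
      (hS.ne_one_of_mem hg)
  · rw [ColoredWalk.sum_mul_one_sub_dmat, ColoredWalk.limitMatrix_apply hX hS hnn htr,
      ColoredWalk.measureReal_hitThen_pathCone hS hL hnn ht hg]
    simp only [ColoredWalk.q_eq_hitMatrix hX]
    rw [← ColoredWalk.one_sub_firstLetterProb_inv hS hL hnn ht hg]
    rfl

theorem mainTheorem9 {d m r : ℕ} {Ω : Type*} [MeasurableSpace Ω]
    (p : FreeGp d m → Matrix (Fin r) (Fin r) ℝ) (hp : IsColoredKernel p)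
    (hnn : ∀ g, g ∉ FreeGp.S d m → p g = 0)
    (ℙ : Fin r → Measure Ω) (X : ℕ → Ω → FreeGp d m × Fin r)
    (hX : ∀ u, IsColoredWalk p u (ℙ u) X)
    (htr : ColoredWalk.IsTransient ℙ X) :
    (∀ u, ∀ᵐ ω ∂ℙ u, ∃! ξ : ℕ → FreeGp d m, ColoredWalk.IsLimit X ω ξ) ∧
    ∀ g ∈ FreeGp.S d m,
      IsUnit (1 - ColoredWalk.q ℙ X g⁻¹ * ColoredWalk.q ℙ X g) ∧
      ∀ u v, ColoredWalk.mu ℙ X g u v =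
        ColoredWalk.q ℙ X g u v *
          ∑ w, ((1 - ColoredWalk.q ℙ X g⁻¹ * ColoredWalk.q ℙ X g)⁻¹ *
            (1 - ColoredWalk.dmat ℙ X g⁻¹)) v w :=
  mainTheorem9_general (FreeGp.hasUniqueReducedWords d m) p hnn ℙ X hX htr
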